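/- For a finite group $G$, written multiplicatively, with identity element $1$ and exponent $\exp(G)$, let the Harborth constant $\mathsf{g}(G)$ be the least integer $k$ with $0 \le k \le |G|$ such that every subset $A \subseteq G$ with $|A| = k$ contains a subset $B \subseteq A$ with $|B| = \exp(G)$ whose elements can be arranged in some order, each used exactly once, so that their product is $1$; if no such $k$ exists, put $\mathsf{g}(G) = |G| + 1$. For every integer $n \ge 3$, the dihedral group $D_{2n} = \langle x, y \mid x^2 = y^n = (xy)^2 = 1 \rangle$ of order $2n$ satisfies \[ \mathsf{g}(D_{2n}) = \begin{cases} n+2 & \text{if } n \text{ is even},\\ 2n+1 & \text{if } n \text{ is odd}. \end{cases} \] -/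

import Mathlib

/-- A finite set `B` of elements of `G` is a one-product set if its elements, each used exactly
once, can be ordered so that their product is `1`. -/
def IsOneProduct {G : Type*} [Group G] (B : Finset G) : Prop :=
  ∃ l : List G, (l : Multiset G) = B.val ∧ l.prod = 1

/-- Every subset of `G` with exactly `k` elements contains a one-product subset with `exp(G)`
elements. -/
def ForcesOneProduct (G : Type*) [Group G] (k : ℕ) : Prop :=
  ∀ A : Finset G, A.card = k →
    ∃ B : Finset G, B ⊆ A ∧ B.card = Monoid.exponent G ∧ IsOneProduct B

open Classical in
/-- The Harborth constant `g(G)` of a finite group: the least size `k ≤ |G|` such that every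
`k`-element subset contains a one-product subset with `exp(G)` elements, and `|G| + 1` if there
is no such `k`. -/
noncomputable def harborthConstant (G : Type*) [Group G] [Finite G] : ℕ :=
  if h : ∃ k : ℕ, k ≤ Nat.card G ∧ ForcesOneProduct G k then Nat.find h else Nat.card G + 1

/-! Let n = 2N. Pair up the reflections of a subset: `sr b * sr c = r (c - b)`, swapping a pair
negates its difference, and a rotation put between two reflections is inverted. So, given at least
one pair, every signed sum of rotation indices and pair differences is the index of some ordered
product. If the unsigned sum is 2t, negating terms with sum s gives 2(t - s), so s ≡ t mod N
suffices. Such s exists if, for each divisor q > 1 of N, at least q - 1 terms are not divisible by q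
(`exists_mem_subsetSums_modEq`). Pairing cyclically consecutive reflections makes few differences
divisible by q (`exists_pairing_zmod`), which settles q ≥ 3 when N ≥ 4 (`sub_one_le_of_counts`); q =
2 needs one odd term. From n + 2 elements, two can be deleted so that all parity conditions hold
(`class_count_selection`).

For the lower bounds, a one-product set has evenly many reflections. If n is even, all rotations
plus one reflection leave only the set of all rotations as candidate, and its index sum is nonzero.
If n is odd, the exponent is 2n, so the only candidate is the whole group, with n reflections. -/

/-! ### Subset sums modulo N -/

/-- The set of sums of all sublists of a list. -/
def subsetSums {M : Type*} [AddCommMonoid M] [DecidableEq M] : List M → Finset M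
  | [] => {0}
  | d :: L => subsetSums L ∪ (subsetSums L).image (d + ·)

theorem mem_subsetSums_cons {M : Type*} [AddCommMonoid M] [DecidableEq M] {d x : M} {L : List M} :
    x ∈ subsetSums (d :: L) ↔ x ∈ subsetSums L ∨ ∃ y ∈ subsetSums L, d + y = x := by
  simp [subsetSums]

theorem mem_subsetSums_map {M K : Type*} [AddCommMonoid M] [DecidableEq M] [AddCommMonoid K]
    [DecidableEq K] (f : M →+ K) (L : List M) (y : K) :
    y ∈ subsetSums (L.map f) ↔ ∃ s ∈ subsetSums L, f s = y := by
  induction L generalizing y with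
  | nil => simp [subsetSums, eq_comm]
  | cons d L ih =>
    simp only [List.map_cons, mem_subsetSums_cons, ih]
    constructor
    · rintro (⟨s, hs, rfl⟩ | ⟨_, ⟨s, hs, rfl⟩, rfl⟩)
      · exact ⟨s, Or.inl hs, rfl⟩
      · exact ⟨d + s, Or.inr ⟨s, hs, rfl⟩, map_add f d s⟩
    · rintro ⟨s, hs | ⟨t, ht, rfl⟩, rfl⟩
      · exact Or.inl ⟨s, hs, rfl⟩
      · exact Or.inr ⟨f t, ⟨t, ht, rfl⟩, (map_add f d t).symm⟩

theorem exists_add_of_mem_subsetSums_append {M : Type*} [AddCommMonoid M] [DecidableEq M]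
    (L₁ L₂ : List M) {s : M} (hs : s ∈ subsetSums (L₁ ++ L₂)) :
    ∃ s₁ ∈ subsetSums L₁, ∃ s₂ ∈ subsetSums L₂, s = s₁ + s₂ := by
  induction L₁ generalizing s with
  | nil => exact ⟨0, by simp [subsetSums], s, hs, by simp⟩
  | cons d L ih =>
    rw [List.cons_append, mem_subsetSums_cons] at hs
    rcases hs with hs | ⟨y, hy, rfl⟩
    · obtain ⟨s₁, h₁, s₂, h₂, rfl⟩ := ih hs
      exact ⟨s₁, mem_subsetSums_cons.2 (Or.inl h₁), s₂, h₂, rfl⟩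
    · obtain ⟨s₁, h₁, s₂, h₂, rfl⟩ := ih hy
      exact ⟨d + s₁, mem_subsetSums_cons.2 (Or.inr ⟨s₁, h₁, rfl⟩), s₂, h₂, (add_assoc _ _ _).symm⟩

/-- A subset sum of the image of a list comes from splitting the list into two parts. -/
theorem exists_perm_of_mem_subsetSums_map {α M : Type*} [AddCommMonoid M] [DecidableEq M]
    (f : α → M) (L : List α) {s : M} (hs : s ∈ subsetSums (L.map f)) :
    ∃ P Q : List α, (P ++ Q).Perm L ∧ (Q.map f).sum = s := by
  induction L generalizing s with
  | nil => exact ⟨[], [], by simp, by simpa [subsetSums, eq_comm] using hs⟩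
  | cons d L ih =>
    rw [List.map_cons, mem_subsetSums_cons] at hs
    rcases hs with hs | ⟨y, hy, rfl⟩
    · obtain ⟨P, Q, h, rfl⟩ := ih hs
      exact ⟨d :: P, Q, h.cons d, rfl⟩
    · obtain ⟨P, Q, h, rfl⟩ := ih hy
      exact ⟨P, d :: Q, List.perm_middle.trans (h.cons d), by simp⟩

/-- If the set of subset sums has trivial stabilizer, then every nonzero term enlarges it. -/
theorem countP_lt_card_subsetSums {G : Type*} [AddCommGroup G] [DecidableEq G] (L : List G)
    (h : ∀ g : G, (∀ y ∈ subsetSums L, g + y ∈ subsetSums L) → g = 0) :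
    L.countP (· ≠ 0) < (subsetSums L).card := by
  induction L with
  | nil => simp [subsetSums]
  | cons d L ih =>
    -- A period of the sums of `L` is also a period of the sums of `d :: L`.
    have key := ih fun g hg ↦ h g fun y hy ↦ by
      rw [mem_subsetSums_cons] at hy ⊢
      rcases hy with hy | ⟨z, hz, rfl⟩
      · exact Or.inl (hg y hy)
      · exact Or.inr ⟨g + z, hg z hz, by abel⟩
    have hsub : subsetSums L ⊆ subsetSums (d :: L) := fun y hy ↦ mem_subsetSums_cons.2 (Or.inl hy)
    by_cases hd : d = 0
    · simpa [hd] using key.trans_le (Finset.card_le_card (hd ▸ hsub))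
    · have hlt : (subsetSums L).card < (subsetSums (d :: L)).card := by
        by_contra hcard
        have heq := Finset.eq_of_subset_of_card_le hsub (not_lt.1 hcard)
        -- If nothing was gained, `d` is a period of the unchanged set, hence zero.
        refine hd (h d fun y hy ↦ mem_subsetSums_cons.2 (Or.inr ⟨y, ?_, rfl⟩))
        rwa [heq]
      rw [List.countP_cons_of_pos (by simpa using hd)]
      omega

/-- If, for every divisor `q > 1` of `N`, at least `q - 1` terms are not divisible by `q`, then the
subset sums cover all residues modulo `N`. -/
theorem exists_mem_subsetSums_modEq (L : List ℤ) (N : ℕ) (hN : 0 < N)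
    (h : ∀ q : ℕ, 1 < q → q ∣ N → q - 1 ≤ L.countP (fun d ↦ ¬ (q : ℤ) ∣ d)) (t : ℤ) :
    ∃ s ∈ subsetSums L, (N : ℤ) ∣ t - s := by
  induction N using Nat.strong_induction_on generalizing t with
  | _ N ih =>
    have : NeZero N := ⟨hN.ne'⟩
    let c := Int.castAddHom (ZMod N)
    have hc (z : ℤ) : c z = (z : ZMod N) := rfl
    by_cases hstab : ∀ g : ZMod N, (∀ y ∈ subsetSums (L.map c), g + y ∈ subsetSums (L.map c)) → g = 0
    · have hcard := countP_lt_card_subsetSums _ hstab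
      have huniv : subsetSums (L.map c) = Finset.univ := by
        rw [← Finset.card_eq_iff_eq_univ, ZMod.card]
        have hle : (subsetSums (L.map c)).card ≤ N := by
          simpa using Finset.card_le_univ (subsetSums (L.map c))
        rcases Nat.lt_or_ge 1 N with h1 | h1
        · have hq := h N h1 dvd_rfl
          have hcount : (L.map c).countP (· ≠ 0) = L.countP (fun d ↦ ¬ (N : ℤ) ∣ d) := by
            rw [List.countP_map]
            congr 1
            funext d
            simp [hc, ZMod.intCast_zmod_eq_zero_iff_dvd]
          omega
        · omega
      obtain ⟨s, hs, hst⟩ := (mem_subsetSums_map c L (t : ZMod N)).1 (by simp [huniv])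
      refine ⟨s, hs, ?_⟩
      rw [← ZMod.intCast_zmod_eq_zero_iff_dvd]
      simp [← hst, hc]
    · push Not at hstab
      obtain ⟨g, hg, hg0⟩ := hstab
      have hmul (m : ℕ) : ∀ y ∈ subsetSums (L.map c), m • g + y ∈ subsetSums (L.map c) := by
        induction m with
        | zero => simp
        | succ m ihm =>
          intro y hy
          rw [succ_nsmul', add_assoc]
          exact hg _ (ihm y hy)
      have hval : 0 < g.val := Nat.pos_of_ne_zero (by simpa using hg0)
      have hdvd : Nat.gcd g.val N ∣ N := Nat.gcd_dvd_right _ _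
      have hlt : Nat.gcd g.val N < N :=
        (Nat.le_of_dvd hval (Nat.gcd_dvd_left _ _)).trans_lt (ZMod.val_lt g)
      obtain ⟨s, hs, k, hk⟩ := ih _ hlt (Nat.gcd_pos_of_pos_left _ hval)
        (fun q hq hqd ↦ h q hq (hqd.trans hdvd)) t
      -- By Bézout, gcd(g, N) is a multiple of `g` modulo N, so `t` is `s` shifted by a period.
      have hts : (t : ZMod N) = ((Nat.gcdA g.val N * k : ℤ) : ZMod N).val • g + c s := by
        have ht : t = (g.val * Nat.gcdA g.val N + N * Nat.gcdB g.val N) * k + s := by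
          rw [← Nat.gcd_eq_gcd_ab]
          linarith
        rw [nsmul_eq_mul, ZMod.natCast_zmod_val, ht, hc]
        push_cast
        rw [ZMod.natCast_zmod_val, ZMod.natCast_self]
        ring
      obtain ⟨s', hs', hst⟩ := (mem_subsetSums_map c L (t : ZMod N)).1
        (hts ▸ hmul _ _ ((mem_subsetSums_map c L _).2 ⟨s, hs, rfl⟩))
      refine ⟨s', hs', ?_⟩
      rw [← ZMod.intCast_zmod_eq_zero_iff_dvd]
      simp [← hst, hc]

/-! ### Pairings with few differences divisible by q -/

/-- The list of all entries of a list of pairs. -/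
def pairEntries {α : Type*} (T : List (α × α)) : List α := T.flatMap fun p ↦ [p.1, p.2]

theorem pairEntries_nil {α : Type*} : pairEntries ([] : List (α × α)) = [] := rfl

theorem pairEntries_cons {α : Type*} (p : α × α) (T : List (α × α)) :
    pairEntries (p :: T) = p.1 :: p.2 :: pairEntries T := rfl

theorem pairEntries_append {α : Type*} (T U : List (α × α)) :
    pairEntries (T ++ U) = pairEntries T ++ pairEntries U := by
  simp [pairEntries]

theorem pairEntries_map {α β : Type*} (f : α → β) (T : List (α × α)) :
    pairEntries (T.map (Prod.map f f)) = (pairEntries T).map f := by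
  induction T with
  | nil => rfl
  | cons p T ih => simp [pairEntries_cons, ih]

theorem pairEntries_perm {α : Type*} {T U : List (α × α)} (h : T.Perm U) :
    (pairEntries T).Perm (pairEntries U) :=
  h.flatMap_right _

theorem pairEntries_map_swap_perm {α : Type*} (T : List (α × α)) :
    (pairEntries (T.map Prod.swap)).Perm (pairEntries T) := by
  induction T with
  | nil => rfl
  | cons p T ih =>
    simp only [List.map_cons, pairEntries_cons, Prod.fst_swap, Prod.snd_swap]
    exact (List.Perm.swap _ _ _).trans ((ih.cons _).cons _)

theorem length_pairEntries {α : Type*} (T : List (α × α)) :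
    (pairEntries T).length = 2 * T.length := by
  induction T with
  | nil => rfl
  | cons p T ih => simp only [pairEntries_cons, List.length_cons, ih]; ring

/-- Adding a pair `a < b` below all entries preserves the bound on the number of pairs with
difference divisible by `q`. -/
theorem pairing_cons {S : Finset ℤ} {t u a b : ℤ} {T : List (ℤ × ℤ)} (hta : t ≤ a) (hab : a < b)
    (hS : ∀ x ∈ S, b < x) (hT : (pairEntries T : Multiset ℤ) = S.val)
    (hq : ∀ q : ℕ, 2 ≤ q →
      (T.countP (fun p ↦ (q : ℤ) ∣ p.2 - p.1) : ℤ) * (q - 1) + S.card ≤ u - (b + 1)) :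
    (pairEntries ((a, b) :: T) : Multiset ℤ) = (insert a (insert b S)).val ∧
      ∀ q : ℕ, 2 ≤ q → (((a, b) :: T).countP (fun p ↦ (q : ℤ) ∣ p.2 - p.1) : ℤ) * (q - 1) +
        (insert a (insert b S)).card ≤ u - t := by
  have hb : b ∉ S := fun h ↦ (hS b h).false
  have ha : a ∉ insert b S := by
    rw [Finset.mem_insert, not_or]
    exact ⟨hab.ne, fun h ↦ (hab.trans (hS a h)).false⟩
  constructor
  · rw [Finset.insert_val_of_notMem ha, Finset.insert_val_of_notMem hb, ← hT]
    rfl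
  · intro q h2
    have h := hq q h2
    rw [Finset.card_insert_of_notMem ha, Finset.card_insert_of_notMem hb, List.countP_cons]
    by_cases hd : (q : ℤ) ∣ b - a
    · have := Int.le_of_dvd (by omega) hd
      simp only [hd, decide_true, if_true]
      push_cast
      linarith
    · simp only [hd, decide_false, Bool.false_eq_true, if_false]
      push_cast
      linarith

/-- Pairing consecutive elements of a set of integers in an interval: for each `q`, few pairs have
difference divisible by `q`. -/
theorem exists_pairing_int (m : ℕ) (S : Finset ℤ) (t u : ℤ) (htu : t ≤ u)
    (hS : ∀ x ∈ S, t ≤ x ∧ x < u) (hm : S.card = 2 * m) :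
    ∃ T : List (ℤ × ℤ), (pairEntries T : Multiset ℤ) = S.val ∧ ∀ q : ℕ, 2 ≤ q →
      (T.countP (fun p ↦ (q : ℤ) ∣ p.2 - p.1) : ℤ) * (q - 1) + S.card ≤ u - t := by
  induction m generalizing S t with
  | zero =>
    obtain rfl : S = ∅ := Finset.card_eq_zero.1 (by omega)
    exact ⟨[], rfl, fun q _ ↦ by simp; omega⟩
  | succ m ih =>
    have hne : S.Nonempty := Finset.card_pos.1 (by omega)
    have hmem := S.min'_mem hne
    set a := S.min' hne with ha
    have hcard := Finset.card_erase_of_mem hmem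
    have hne' : (S.erase a).Nonempty := Finset.card_pos.1 (by omega)
    have hmem' := (S.erase a).min'_mem hne'
    set b := (S.erase a).min' hne' with hb
    have hcard' := Finset.card_erase_of_mem hmem'
    have hab : a < b :=
      lt_of_le_of_ne (S.min'_le _ (Finset.mem_of_mem_erase hmem')) (Finset.ne_of_mem_erase hmem').symm
    have hlt : ∀ x ∈ (S.erase a).erase b, b < x := fun x hx ↦
      lt_of_le_of_ne ((S.erase a).min'_le _ (Finset.mem_of_mem_erase hx))
        (Finset.ne_of_mem_erase hx).symm
    have hbS := hS b (Finset.mem_of_mem_erase hmem')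
    obtain ⟨T, hT, hq⟩ := ih ((S.erase a).erase b) (b + 1) (by omega)
      (fun x hx ↦ ⟨hlt x hx, (hS x (Finset.mem_of_mem_erase (Finset.mem_of_mem_erase hx))).2⟩)
      (by omega)
    have := pairing_cons (hS a hmem).1 hab hlt hT hq
    rw [Finset.insert_erase hmem', Finset.insert_erase hmem] at this
    exact ⟨_, this⟩

/-- Consecutive pairing starts with the two smallest elements; this records that pair, so that its
difference can later be chosen odd. -/
theorem exists_pairing_int_of_gap (S : Finset ℤ) (u g : ℤ) (hS : ∀ x ∈ S, 0 ≤ x ∧ x < u)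
    (hm : Even S.card) (h0 : 0 ∈ S) (hg : g ∈ S) (hg0 : 0 < g) (hgap : ∀ x ∈ S, 0 < x → g ≤ x) :
    ∃ T : List (ℤ × ℤ), (pairEntries T : Multiset ℤ) = S.val ∧ (∀ q : ℕ, 2 ≤ q →
      (T.countP (fun p ↦ (q : ℤ) ∣ p.2 - p.1) : ℤ) * (q - 1) + S.card ≤ u) ∧ (0, g) ∈ T := by
  have hg' : g ∈ S.erase 0 := Finset.mem_erase.2 ⟨hg0.ne', hg⟩
  have hlt : ∀ x ∈ (S.erase 0).erase g, g < x := fun x hx ↦ by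
    simp only [Finset.mem_erase] at hx
    have := hS x hx.2.2
    have := hgap x hx.2.2 (by omega)
    omega
  have hcard := Finset.card_erase_of_mem h0
  have hcard' := Finset.card_erase_of_mem hg'
  obtain ⟨m, hm⟩ := hm
  obtain ⟨T, hT, hq⟩ := exists_pairing_int (m - 1) ((S.erase 0).erase g) (g + 1) u
    (by have := hS g hg; omega)
    (fun x hx ↦ ⟨hlt x hx, (hS x (Finset.mem_of_mem_erase (Finset.mem_of_mem_erase hx))).2⟩)
    (by omega)
  have := pairing_cons le_rfl hg0 hlt hT hq
  rw [Finset.insert_erase hg', Finset.insert_erase h0] at this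
  exact ⟨_, this.1, by simpa using this.2, List.mem_cons_self⟩

/-- The integer difference of the representatives of a pair of residues. -/
def valDiff {n : ℕ} (p : ZMod n × ZMod n) : ℤ := (p.2.val : ℤ) - p.1.val

theorem intCast_valDiff {n : ℕ} [NeZero n] (p : ZMod n × ZMod n) :
    (valDiff p : ZMod n) = p.2 - p.1 := by
  simp [valDiff]

theorem dvd_valDiff_add_intCast {n q : ℕ} [NeZero n] (hq : q ∣ n) (x : ZMod n) (p : ℤ × ℤ) :
    (q : ℤ) ∣ valDiff (x + (p.1 : ZMod n), x + (p.2 : ZMod n)) ↔ (q : ℤ) ∣ p.2 - p.1 := by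
  have h : (n : ℤ) ∣ valDiff (x + (p.1 : ZMod n), x + (p.2 : ZMod n)) - (p.2 - p.1) := by
    rw [← ZMod.intCast_zmod_eq_zero_iff_dvd, Int.cast_sub, intCast_valDiff]
    push_cast
    ring
  exact dvd_iff_dvd_of_dvd_sub ((Int.natCast_dvd_natCast.2 hq).trans h)

/-- Cyclic version of `exists_pairing_int`; if both parities occur, then some pair can be taken to
have odd difference. -/
theorem exists_pairing_zmod {n : ℕ} [NeZero n] (h2 : 2 ∣ n) (S : Finset (ZMod n))
    (hS : Even S.card) :
    ∃ T : List (ZMod n × ZMod n), (pairEntries T : Multiset (ZMod n)) = S.val ∧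
      (∀ q : ℕ, 2 ≤ q → q ∣ n →
        T.countP (fun p ↦ (q : ℤ) ∣ valDiff p) * (q - 1) + S.card ≤ n) ∧
      ((∃ x ∈ S, ∃ y ∈ S, ¬ 2 ∣ valDiff (x, y)) → ∃ p ∈ T, ¬ 2 ∣ valDiff p) := by
  have hinj (x : ZMod n) : Function.Injective fun b : ZMod n ↦ (((b - x).val : ℕ) : ℤ) :=
    fun b c hbc ↦ sub_left_injective (ZMod.val_injective n (Nat.cast_injective hbc))
  have transfer (x : ZMod n) (T : List (ℤ × ℤ))
      (hT : (pairEntries T : Multiset ℤ) = (S.image fun b ↦ (((b - x).val : ℕ) : ℤ)).val)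
      (hq : ∀ q : ℕ, 2 ≤ q → (T.countP (fun p ↦ (q : ℤ) ∣ p.2 - p.1) : ℤ) * (q - 1) +
        (S.image fun b ↦ (((b - x).val : ℕ) : ℤ)).card ≤ n) :
      (pairEntries (T.map (Prod.map (fun z : ℤ ↦ x + (z : ZMod n)) fun z : ℤ ↦ x + (z : ZMod n))) :
        Multiset (ZMod n)) = S.val ∧
      ∀ q : ℕ, 2 ≤ q → q ∣ n →
        (T.map (Prod.map (fun z : ℤ ↦ x + (z : ZMod n)) fun z : ℤ ↦ x + (z : ZMod n))).countP
          (fun p ↦ (q : ℤ) ∣ valDiff p) * (q - 1) + S.card ≤ n := by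
    constructor
    · rw [pairEntries_map, ← Multiset.map_coe, hT, Finset.image_val_of_injOn (hinj x).injOn,
        Multiset.map_map]
      simp
    · intro q h2 hqn
      have h := hq q h2
      rw [Finset.card_image_of_injective _ (hinj x)] at h
      have hcount : (T.map (Prod.map (fun z : ℤ ↦ x + (z : ZMod n))
          fun z : ℤ ↦ x + (z : ZMod n))).countP (fun p ↦ (q : ℤ) ∣ valDiff p) =
          T.countP (fun p ↦ (q : ℤ) ∣ p.2 - p.1) := by
        rw [List.countP_map]
        congr 1
        funext p
        exact decide_eq_decide.2 (dvd_valDiff_add_intCast hqn x p)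
      rw [hcount]
      zify [show 1 ≤ q by omega]
      exact h
  have hrange (x : ZMod n) : ∀ z ∈ S.image fun b ↦ (((b - x).val : ℕ) : ℤ), 0 ≤ z ∧ z < n := by
    intro z hz
    obtain ⟨b, -, rfl⟩ := Finset.mem_image.1 hz
    exact ⟨by positivity, by exact_mod_cast ZMod.val_lt _⟩
  have hcard (x : ZMod n) : (S.image fun b ↦ (((b - x).val : ℕ) : ℤ)).card = S.card :=
    Finset.card_image_of_injective _ (hinj x)
  have hodd (x y : ZMod n) : (2 : ℤ) ∣ valDiff (x, y) ↔ (2 : ℤ) ∣ ((y - x).val : ℤ) := by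
    have := dvd_valDiff_add_intCast h2 x (0, ((y - x).val : ℤ))
    simpa using this
  by_cases hbi : ∃ x ∈ S, ∃ y ∈ S, ¬ 2 ∣ valDiff (x, y)
  · have hne : ((S ×ˢ S).filter fun p ↦ ¬ 2 ∣ valDiff p).Nonempty := by
      obtain ⟨x, hx, y, hy, h⟩ := hbi
      exact ⟨(x, y), Finset.mem_filter.2 ⟨Finset.mk_mem_product hx hy, h⟩⟩
    -- Start at an opposite-parity pair of least cyclic distance: an element strictly between would
    -- form a closer such pair with `x` or `y`, so `y` directly follows `x`.
    obtain ⟨⟨x, y⟩, hxy, hmin⟩ := Finset.exists_min_image _ (fun p ↦ (p.2 - p.1).val) hne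
    simp only [Finset.mem_filter, Finset.mem_product] at hxy hmin
    obtain ⟨⟨hx, hy⟩, hxy⟩ := hxy
    have hpos : 0 < (y - x).val := by
      refine Nat.pos_of_ne_zero fun h ↦ hxy ((hodd x y).2 ?_)
      simp [h]
    obtain ⟨T, hT, hq, hmem⟩ := exists_pairing_int_of_gap
      (S.image fun b ↦ (((b - x).val : ℕ) : ℤ)) n ((y - x).val) (hrange x) (by rwa [hcard])
      (Finset.mem_image.2 ⟨x, hx, by simp⟩) (Finset.mem_image.2 ⟨y, hy, rfl⟩)
      (by exact_mod_cast hpos) (by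
        intro z hz hz0
        obtain ⟨b, hb, rfl⟩ := Finset.mem_image.1 hz
        by_contra! hlt
        by_cases hbx : (2 : ℤ) ∣ ((b - x).val : ℤ)
        · have hval : (y - b).val = (y - x).val - (b - x).val := by
            rw [← ZMod.val_sub (by omega)]
            congr 1
            ring
          have hby : valDiff (b, y) = valDiff (x, y) - valDiff (x, b) := by
            simp [valDiff]
          have := hmin (b, y) ⟨⟨hb, hy⟩, by rw [← hodd] at hbx; omega⟩
          simp only at this
          omega
        · have := hmin (x, b) ⟨⟨hx, hb⟩, by rwa [hodd]⟩
          simp only at this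
          omega)
    obtain ⟨h₁, h₂⟩ := transfer x T hT hq
    refine ⟨_, h₁, h₂, fun _ ↦ ⟨_, List.mem_map_of_mem hmem, ?_⟩⟩
    simpa using hxy
  · obtain ⟨m, hm⟩ := hS
    obtain ⟨T, hT, hq⟩ := exists_pairing_int m (S.image fun b ↦ (((b - 0).val : ℕ) : ℤ)) 0 n
      (by positivity) (hrange 0) (by rw [hcard]; omega)
    obtain ⟨h₁, h₂⟩ := transfer 0 T hT (by simpa using hq)
    exact ⟨_, h₁, h₂, fun h ↦ absurd h hbi⟩

/-- Four distinct residues modulo `6` can be paired without differences divisible by `3`. -/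
theorem exists_pairing_zmod_six (T : List (ZMod 6 × ZMod 6)) (hT : T.length = 2)
    (hnd : (pairEntries T).Nodup) :
    ∃ U : List (ZMod 6 × ZMod 6), (pairEntries U).Perm (pairEntries T) ∧
      U.countP (fun p ↦ ¬ (3 : ℤ) ∣ valDiff p) = 2 := by
  obtain ⟨⟨a, b⟩, ⟨c, d⟩, rfl⟩ := List.length_eq_two.1 hT
  simp only [pairEntries_cons, pairEntries_nil] at hnd ⊢
  have key : ∀ x y : ZMod 6, (3 : ℤ) ∣ valDiff (x, y) ↔ y = x ∨ y = x + 3 := by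
    unfold valDiff; decide
  have h6 : (3 : ZMod 6) + 3 = 0 := by decide
  by_cases h : (3 : ℤ) ∣ valDiff (a, b) ∨ (3 : ℤ) ∣ valDiff (c, d)
  · refine ⟨[(a, c), (b, d)], (List.Perm.swap b c [d]).cons a, ?_⟩
    have h₁ : ¬ (3 : ℤ) ∣ valDiff (a, c) := by rw [key] at h ⊢; grind
    have h₂ : ¬ (3 : ℤ) ∣ valDiff (b, d) := by rw [key] at h ⊢; grind
    simp [h₁, h₂]
  · rw [not_or] at h
    exact ⟨[(a, b), (c, d)], List.Perm.refl _, by simp [h.1, h.2]⟩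

/-! ### Ordered products as signed sums -/

theorem prod_map_r {n : ℕ} (P : List (ZMod n)) :
    (P.map DihedralGroup.r).prod = DihedralGroup.r P.sum := by
  induction P with
  | nil => rfl
  | cons a P ih => rw [List.map_cons, List.prod_cons, ih, DihedralGroup.r_mul_r, List.sum_cons]

theorem prod_map_sr_pairEntries {n : ℕ} (T : List (ZMod n × ZMod n)) :
    ((pairEntries T).map DihedralGroup.sr).prod =
      DihedralGroup.r (T.map fun p ↦ p.2 - p.1).sum := by
  induction T with
  | nil => rfl
  | cons p T ih =>
    rw [pairEntries_cons, List.map_cons, List.map_cons, List.prod_cons, List.prod_cons, ih,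
      ← mul_assoc, DihedralGroup.sr_mul_sr, DihedralGroup.r_mul_r, List.map_cons, List.sum_cons]

/-- Rotations and pairs of reflections can be ordered so that chosen rotations are inverted. -/
theorem exists_perm_prod_eq {n : ℕ} (P Q : List (ZMod n)) (T : List (ZMod n × ZMod n))
    (hT : T ≠ []) :
    ∃ l : List (DihedralGroup n),
      l.Perm ((P ++ Q).map DihedralGroup.r ++ (pairEntries T).map DihedralGroup.sr) ∧
      l.prod = DihedralGroup.r (P.sum - Q.sum + (T.map fun p ↦ p.2 - p.1).sum) := by
  obtain ⟨⟨b, c⟩, W, rfl⟩ := List.exists_cons_of_ne_nil hT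
  -- The rotations in `Q` stand between the reflections `b` and `c`, hence count negatively.
  refine ⟨P.map DihedralGroup.r ++ (DihedralGroup.sr b :: (Q.map DihedralGroup.r ++
    DihedralGroup.sr c :: (pairEntries W).map DihedralGroup.sr)), ?_, ?_⟩
  · rw [List.map_append, List.append_assoc, pairEntries_cons]
    refine List.Perm.append_left _ ?_
    simp only [List.map_cons]
    refine List.Perm.trans ?_ List.perm_middle.symm
    exact (List.perm_middle.trans List.perm_middle.symm).cons _
  · simp only [List.prod_append, List.prod_cons, prod_map_r, prod_map_sr_pairEntries,
      DihedralGroup.r_mul_sr, DihedralGroup.sr_mul_r, DihedralGroup.sr_mul_sr,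
      DihedralGroup.r_mul_r, List.map_cons, List.sum_cons]
    congr 1
    ring

/-- A sum and a difference have equal parity, so this parity does not depend on the pairing. -/
theorem even_sum_of_pairs {n : ℕ} (R : List (ZMod n)) (T : List (ZMod n × ZMod n)) :
    Even (R.map (fun a ↦ (a.val : ℤ)) ++ T.map valDiff).sum ↔
      Even ((R.map ZMod.val).sum + ((pairEntries T).map ZMod.val).sum) := by
  rw [List.sum_append, Int.even_add, Nat.even_add]
  have h₁ : (R.map (fun a ↦ (a.val : ℤ))).sum = ((R.map ZMod.val).sum : ℕ) := by
    rw [Nat.cast_list_sum, List.map_map]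
    rfl
  have h₂ : Even (T.map valDiff).sum ↔ Even ((pairEntries T).map ZMod.val).sum := by
    induction T with
    | nil => simp [pairEntries_nil]
    | cons p T ih =>
      simp only [pairEntries_cons, List.map_cons, List.sum_cons, valDiff] at ih ⊢
      grind
  rw [h₁, h₂, Int.even_coe_nat]

/-- A criterion for ordering rotations and pairs of reflections with product `1`. -/
theorem exists_perm_prod_eq_one {n N : ℕ} [NeZero n] (hn : n = 2 * N) (R : List (ZMod n))
    (T : List (ZMod n × ZMod n)) (hT : T ≠ [])
    (heven : Even ((R.map ZMod.val).sum + ((pairEntries T).map ZMod.val).sum))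
    (h : ∀ q : ℕ, 1 < q → q ∣ N → q - 1 ≤ R.countP (fun a ↦ ¬ (q : ℤ) ∣ (a.val : ℤ)) +
      T.countP (fun p ↦ ¬ (q : ℤ) ∣ valDiff p)) :
    ∃ l : List (DihedralGroup n),
      l.Perm (R.map DihedralGroup.r ++ (pairEntries T).map DihedralGroup.sr) ∧ l.prod = 1 := by
  have hN : 0 < N := by
    have := NeZero.ne n
    omega
  obtain ⟨t, ht⟩ := (even_sum_of_pairs R T).2 heven
  obtain ⟨s, hs, hdvd⟩ := exists_mem_subsetSums_modEq
    (R.map (fun a ↦ (a.val : ℤ)) ++ T.map valDiff) N hN (fun q h1 hq ↦ by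
      rw [List.countP_append, List.countP_map, List.countP_map]
      exact h q h1 hq) t
  obtain ⟨s₁, hs₁, s₂, hs₂, rfl⟩ := exists_add_of_mem_subsetSums_append _ _ hs
  obtain ⟨P, Q, hPQ, hQ⟩ := exists_perm_of_mem_subsetSums_map _ R hs₁
  obtain ⟨U, V, hUV, hV⟩ := exists_perm_of_mem_subsetSums_map _ T hs₂
  have hne : U ++ V.map Prod.swap ≠ [] := by
    intro h0
    rw [List.append_eq_nil_iff, List.map_eq_nil_iff] at h0
    rw [h0.1, h0.2] at hUV
    exact hT (List.nil_perm.1 hUV)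
  obtain ⟨l, hl, hprod⟩ := exists_perm_prod_eq P Q _ hne
  refine ⟨l, hl.trans ((hPQ.map _).append (List.Perm.map _ ?_)), ?_⟩
  · rw [pairEntries_append]
    refine List.Perm.trans ?_ (pairEntries_perm hUV)
    rw [pairEntries_append]
    exact (pairEntries_map_swap_perm V).append_left _
  · rw [hprod, DihedralGroup.one_def]
    congr 1
    have hcast (L : List (ZMod n)) :
        (((L.map (fun a ↦ (a.val : ℤ))).sum : ℤ) : ZMod n) = L.sum := by
      induction L with
      | nil => simp
      | cons a L ih => simp only [List.map_cons, List.sum_cons, Int.cast_add, ih]; simp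
    have hcast' (L : List (ZMod n × ZMod n)) :
        (((L.map valDiff).sum : ℤ) : ZMod n) = (L.map fun p ↦ p.2 - p.1).sum := by
      induction L with
      | nil => simp
      | cons a L ih => simp only [List.map_cons, List.sum_cons, Int.cast_add, ih, intCast_valDiff]
    have hswap (L : List (ZMod n × ZMod n)) :
        ((L.map Prod.swap).map fun p ↦ p.2 - p.1).sum = -(L.map fun p ↦ p.2 - p.1).sum := by
      induction L with
      | nil => simp
      | cons a L ih => simp only [List.map_cons, List.sum_cons, ih, Prod.fst_swap, Prod.snd_swap]; ring
    have hR := (hPQ.map fun a ↦ (a.val : ℤ)).sum_eq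
    have hTs := (hUV.map valDiff).sum_eq
    rw [List.map_append, List.sum_append] at hR hTs
    rw [List.sum_append, ← hR, ← hTs] at ht
    -- The signed sum is 2t - 2(s₁ + s₂), and N divides t - (s₁ + s₂).
    have hz : (n : ℤ) ∣ (P.map (fun a ↦ (a.val : ℤ))).sum - (Q.map (fun a ↦ (a.val : ℤ))).sum +
        ((U.map valDiff).sum - (V.map valDiff).sum) := by
      obtain ⟨k, hk⟩ := hdvd
      refine ⟨k, ?_⟩
      subst hn
      push_cast
      rw [← hQ, ← hV] at hk
      linarith
    rw [← ZMod.intCast_zmod_eq_zero_iff_dvd] at hz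
    push_cast at hz
    rw [List.map_append, List.sum_append, hswap, ← hcast, ← hcast, ← hcast', ← hcast', ← hz]
    push_cast
    ring

/-! ### Counting for the divisor condition -/

theorem card_filter_val_mod_le {n q : ℕ} [NeZero n] (hqn : q ∣ n) (c : ℕ)
    (S : Finset (ZMod n)) (hS : ∀ a ∈ S, a.val % q = c) : S.card * q ≤ n := by
  obtain ⟨k, rfl⟩ := hqn
  have : S.card ≤ (Finset.range k).card := by
    refine Finset.card_le_card_of_injOn (fun a ↦ a.val / q) (fun a _ ↦ ?_) fun a ha b hb hab ↦ ?_
    · simpa using Nat.div_lt_of_lt_mul (ZMod.val_lt a)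
    · refine ZMod.val_injective _ ?_
      rw [← Nat.div_add_mod a.val q, ← Nat.div_add_mod b.val q, hS a ha, hS b hb]
      simp only at hab
      rw [hab]
  rw [Finset.card_range] at this
  calc S.card * q ≤ k * q := Nat.mul_le_mul_right q this
    _ = q * k := Nat.mul_comm _ _

/-- The counting inequality behind the choice of pairs: `r` rotations, `β` of them divisible by
`q`, and `m` pairs, `γ` of them with difference divisible by `q`. -/
theorem sub_one_le_of_counts {N q r m β γ : ℕ} (hN : 4 ≤ N) (hq : 3 ≤ q) (hqN : q ∣ N)
    (hr : r + 2 * m = 2 * N) (hβr : β ≤ r) (hβ : β * q ≤ 2 * N)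
    (hγ : γ * (q - 1) + 2 * m ≤ 2 * N) (hγm : γ ≤ m) :
    q - 1 ≤ (r - β) + (m - γ) := by
  obtain ⟨k, rfl⟩ := hqN
  obtain ⟨x, rfl⟩ := Nat.exists_eq_add_of_le hq
  have hβ' : β ≤ 2 * k := by
    refine Nat.le_of_mul_le_mul_right (c := 3 + x) ?_ (by omega)
    linarith
  have hk : 1 ≤ k := Nat.pos_of_ne_zero fun h ↦ by simp [h] at hN
  rw [show 3 + x - 1 = x + 2 by omega] at hγ ⊢
  by_contra! hlt
  zify [hβr, hγm] at hlt
  zify at hN hr hβ hγ hβ' hk hβr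
  have h1 : (r : ℤ) * x ≥ β * x := by gcongr
  have h2 : (β : ℤ) * (x + 4) ≤ 2 * k * (x + 4) := by gcongr
  -- Here q = x + 3 and N = qk. Multiply the negated claim by q - 1, then eliminate `m`, `γ` and
  -- `β`.
  have h3 : (k : ℤ) * ((x + 3) ^ 2 - 2 * (x + 3) - 1) ≤ (x + 3) ^ 2 - 3 * (x + 3) + 2 := by
    have : ((r - β) + (m - γ) : ℤ) * (x + 2) ≤ (x + 1) * (x + 2) :=
      mul_le_mul_of_nonneg_right (by linarith) (by positivity)
    nlinarith
  have h4 : ((k : ℤ) - 1) * ((x + 3) ^ 2 - 2 * (x + 3) - 1) ≥ 0 := by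
    refine mul_nonneg (by omega) (by nlinarith)
  -- Since k ≥ 1, `h3` forces q = 3; then k = 1, against N ≥ 4.
  have hx : x = 0 := by
    zify
    nlinarith
  subst hx
  norm_num at *
  omega

theorem countP_toList_eq_card_filter {α : Type*} (R : Finset α) (p : α → Prop) [DecidablePred p] :
    R.toList.countP (fun a ↦ p a) = (R.filter p).card := by
  rw [← Multiset.coe_countP, Finset.coe_toList, Multiset.countP_eq_card_filter]
  rfl

/-- The reflections can be paired so that the hypothesis of `exists_perm_prod_eq_one` holds. -/
theorem exists_pairing_of_parity {n N : ℕ} [NeZero n] (hn : n = 2 * N) (hN : 2 ≤ N)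
    (R S : Finset (ZMod n)) (hcard : R.card + S.card = 2 * N) (hS : Even S.card)
    (hS2 : 2 ≤ S.card)
    (hodd : (∃ a ∈ R, ¬ (2 : ℤ) ∣ (a.val : ℤ)) ∨ ∃ x ∈ S, ∃ y ∈ S, ¬ 2 ∣ valDiff (x, y)) :
    ∃ T : List (ZMod n × ZMod n), (pairEntries T : Multiset (ZMod n)) = S.val ∧
      ∀ q : ℕ, 1 < q → q ∣ N → q - 1 ≤ R.toList.countP (fun a ↦ ¬ (q : ℤ) ∣ (a.val : ℤ)) +
        T.countP (fun p ↦ ¬ (q : ℤ) ∣ valDiff p) := by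
  obtain ⟨T, hT, hq, hT2⟩ := exists_pairing_zmod ⟨N, hn⟩ S hS
  have hlen : S.card = 2 * T.length := by
    rw [← length_pairEntries, ← Multiset.coe_card, hT]
    rfl
  have hRT (q : ℕ) : R.toList.countP (fun a ↦ ¬ (q : ℤ) ∣ (a.val : ℤ)) =
      R.card - R.toList.countP (fun a ↦ (q : ℤ) ∣ (a.val : ℤ)) := by
    have := List.length_eq_countP_add_countP (l := R.toList)
      (fun a ↦ decide ((q : ℤ) ∣ (a.val : ℤ)))
    simp only [Finset.length_toList, decide_eq_true_eq] at this
    omega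
  have hTT (q : ℕ) : T.countP (fun p ↦ ¬ (q : ℤ) ∣ valDiff p) =
      T.length - T.countP (fun p ↦ (q : ℤ) ∣ valDiff p) := by
    have := List.length_eq_countP_add_countP (l := T) (fun p ↦ decide ((q : ℤ) ∣ valDiff p))
    simp only [decide_eq_true_eq] at this
    omega
  have hβr (q : ℕ) : R.toList.countP (fun a ↦ (q : ℤ) ∣ (a.val : ℤ)) ≤ R.card := by
    simpa using List.countP_le_length (l := R.toList)
      (p := fun a ↦ decide ((q : ℤ) ∣ (a.val : ℤ)))
  have hγm (q : ℕ) : T.countP (fun p ↦ (q : ℤ) ∣ valDiff p) ≤ T.length := List.countP_le_length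
  have hβ (q : ℕ) (hqN : q ∣ N) :
      R.toList.countP (fun a ↦ (q : ℤ) ∣ (a.val : ℤ)) * q ≤ 2 * N := by
    rw [countP_toList_eq_card_filter, ← hn]
    refine card_filter_val_mod_le (hn ▸ hqN.mul_left 2) 0 _ fun a ha ↦ ?_
    exact Nat.mod_eq_zero_of_dvd (Int.natCast_dvd_natCast.1 (Finset.mem_filter.1 ha).2)
  have htwo : 1 ≤ R.toList.countP (fun a ↦ ¬ (2 : ℤ) ∣ (a.val : ℤ)) +
      T.countP (fun p ↦ ¬ (2 : ℤ) ∣ valDiff p) := by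
    rcases hodd with ⟨a, ha, h⟩ | h
    · have : 0 < R.toList.countP (fun a ↦ ¬ (2 : ℤ) ∣ (a.val : ℤ)) :=
        List.countP_pos_iff.2 ⟨a, by simpa using ha, decide_eq_true h⟩
      omega
    · obtain ⟨p, hp, h⟩ := hT2 h
      have : 0 < T.countP (fun p ↦ ¬ (2 : ℤ) ∣ valDiff p) :=
        List.countP_pos_iff.2 ⟨p, hp, decide_eq_true h⟩
      omega
  have hγ (q : ℕ) (h2 : 2 ≤ q) (hqN : q ∣ N) :
      T.countP (fun p ↦ (q : ℤ) ∣ valDiff p) * (q - 1) + 2 * T.length ≤ 2 * N := by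
    rw [← hlen, ← hn]
    exact hq q h2 (hn ▸ hqN.mul_left 2)
  rcases Nat.lt_or_ge N 4 with hN4 | hN4
  · obtain rfl | rfl : N = 2 ∨ N = 3 := by omega
    · refine ⟨T, hT, fun q h1 hq2 ↦ ?_⟩
      obtain rfl : q = 2 := by
        have := Nat.le_of_dvd (by norm_num) hq2
        omega
      exact htwo
    · have hthree : ∀ q : ℕ, 1 < q → q ∣ 3 → q = 3 := fun q h1 hq3 ↦
        ((Nat.dvd_prime Nat.prime_three).1 hq3).resolve_left h1.ne'
      -- With two rotations and two pairs, both rotations and one difference may be divisible by 3,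
      -- so the pairs must be recombined; in the other cases the counts suffice.
      by_cases hT4 : T.length = 2
      · subst hn
        have hnd : (pairEntries T).Nodup := by
          rw [← Multiset.coe_nodup, hT]
          exact S.nodup
        obtain ⟨U, hU, hcount⟩ := exists_pairing_zmod_six T hT4 hnd
        refine ⟨U, (Multiset.coe_eq_coe.2 hU).trans hT, fun q h1 hq3 ↦ ?_⟩
        obtain rfl := hthree q h1 hq3
        push_cast
        omega
      · refine ⟨T, hT, fun q h1 hq3 ↦ ?_⟩
        obtain rfl := hthree q h1 hq3
        have := hβ 3 dvd_rfl
        have := hβr 3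
        have := hγ 3 (by norm_num) dvd_rfl
        have := hγm 3
        rw [hRT, hTT]
        omega
  · refine ⟨T, hT, fun q h1 hqN ↦ ?_⟩
    rcases Nat.lt_or_ge q 3 with h3 | h3
    · obtain rfl : q = 2 := by omega
      exact htwo
    · rw [hRT, hTT]
      exact sub_one_le_of_counts hN4 h3 hqN (by omega) (hβr q) (hβ q hqN) (hγ q h1 hqN) (hγm q)

/-! ### Upper bound for even n -/

/-- The embedding of residues as rotations. -/
def rotEmbedding (n : ℕ) : ZMod n ↪ DihedralGroup n :=
  ⟨DihedralGroup.r, fun _ _ h ↦ DihedralGroup.r.inj h⟩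

/-- The embedding of residues as reflections. -/
def reflEmbedding (n : ℕ) : ZMod n ↪ DihedralGroup n :=
  ⟨DihedralGroup.sr, fun _ _ h ↦ DihedralGroup.sr.inj h⟩

theorem rotEmbedding_apply {n : ℕ} (a : ZMod n) : rotEmbedding n a = DihedralGroup.r a := rfl

theorem reflEmbedding_apply {n : ℕ} (a : ZMod n) : reflEmbedding n a = DihedralGroup.sr a := rfl

/-- The set of rotations with indices in `R` and reflections with indices in `S`. -/
def rotRefl {n : ℕ} (R S : Finset (ZMod n)) : Finset (DihedralGroup n) :=
  (R.map (rotEmbedding n)).disjUnion (S.map (reflEmbedding n)) (by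
    rw [Finset.disjoint_left]
    intro x hx hy
    obtain ⟨a, -, rfl⟩ := Finset.mem_map.1 hx
    obtain ⟨b, -, hb⟩ := Finset.mem_map.1 hy
    exact DihedralGroup.noConfusion rfl (heq_of_eq hb))

theorem card_rotRefl {n : ℕ} (R S : Finset (ZMod n)) :
    (rotRefl R S).card = R.card + S.card := by
  rw [rotRefl, Finset.card_disjUnion, Finset.card_map, Finset.card_map]

theorem r_mem_rotRefl {n : ℕ} {R S : Finset (ZMod n)} {a : ZMod n} :
    DihedralGroup.r a ∈ rotRefl R S ↔ a ∈ R := by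
  simp [rotRefl, rotEmbedding_apply, reflEmbedding_apply]

theorem sr_mem_rotRefl {n : ℕ} {R S : Finset (ZMod n)} {a : ZMod n} :
    DihedralGroup.sr a ∈ rotRefl R S ↔ a ∈ S := by
  simp [rotRefl, rotEmbedding_apply, reflEmbedding_apply]

theorem exists_eq_rotRefl {n : ℕ} [NeZero n] (A : Finset (DihedralGroup n)) :
    ∃ R S : Finset (ZMod n), A = rotRefl R S := by
  refine ⟨Finset.univ.filter fun a ↦ DihedralGroup.r a ∈ A,
    Finset.univ.filter fun a ↦ DihedralGroup.sr a ∈ A, ?_⟩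
  ext (a | a)
  · simp [r_mem_rotRefl]
  · simp [sr_mem_rotRefl]

theorem rotRefl_subset {n : ℕ} {R R' S S' : Finset (ZMod n)} (hR : R' ⊆ R) (hS : S' ⊆ S) :
    rotRefl R' S' ⊆ rotRefl R S := by
  rintro (a | a) h
  · exact r_mem_rotRefl.2 (hR (r_mem_rotRefl.1 h))
  · exact sr_mem_rotRefl.2 (hS (sr_mem_rotRefl.1 h))

theorem isOneProduct_rotRefl {n N : ℕ} [NeZero n] (hn : n = 2 * N) (hN : 2 ≤ N)
    (R S : Finset (ZMod n)) (hcard : R.card + S.card = 2 * N) (hS : Even S.card)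
    (hS2 : 2 ≤ S.card) (hsum : Even (∑ a ∈ R, a.val + ∑ b ∈ S, b.val))
    (hodd : (∃ a ∈ R, ¬ (2 : ℤ) ∣ (a.val : ℤ)) ∨ ∃ x ∈ S, ∃ y ∈ S, ¬ 2 ∣ valDiff (x, y)) :
    IsOneProduct (rotRefl R S) := by
  obtain ⟨T, hT, hq⟩ := exists_pairing_of_parity hn hN R S hcard hS hS2 hodd
  have hne : T ≠ [] := by
    rintro rfl
    rw [Finset.card_def, ← hT] at hS2
    simp [pairEntries_nil] at hS2
  have hsumS : ((pairEntries T).map ZMod.val).sum = ∑ b ∈ S, b.val := by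
    rw [Finset.sum, ← hT, Multiset.map_coe, Multiset.sum_coe]
  obtain ⟨l, hl, hprod⟩ := exists_perm_prod_eq_one hn R.toList T hne
    (by rwa [hsumS, Finset.sum_map_toList]) hq
  refine ⟨l, ?_, hprod⟩
  rw [Multiset.coe_eq_coe.2 hl, ← Multiset.coe_add, ← Multiset.map_coe, ← Multiset.map_coe, hT,
    Finset.coe_toList]
  rfl

/-- The classes are odd and even rotations, then odd and even reflections. Each has at most N
members, so at least three are nonempty, which leaves enough freedom in deleting two elements. -/
theorem class_count_selection {N o e p w : ℕ} (hN : 2 ≤ N) (ho : o ≤ N) (he : e ≤ N) (hp : p ≤ N)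
    (hw : w ≤ N) (h : o + e + (p + w) = 2 * N + 2) :
    ∃ o' e' p' w', o' ≤ o ∧ e' ≤ e ∧ p' ≤ p ∧ w' ≤ w ∧ o' + e' + (p' + w') = 2 * N ∧
      Even (p' + w') ∧ 2 ≤ p' + w' ∧ Even (o' + p') ∧ (1 ≤ o' ∨ (1 ≤ p' ∧ 1 ≤ w')) := by
  simp only [Nat.even_iff]
  by_contra! H
  -- These are the ten ways to delete two elements; where subtraction truncates, the total exceeds
  -- 2N and the candidate is excluded.
  have h1 := H (o - 2) e p w
  have h2 := H (o - 1) (e - 1) p w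
  have h3 := H o (e - 2) p w
  have h4 := H o e (p - 2) w
  have h5 := H o e (p - 1) (w - 1)
  have h6 := H o e p (w - 2)
  have h7 := H (o - 1) e (p - 1) w
  have h8 := H (o - 1) e p (w - 1)
  have h9 := H o (e - 1) (p - 1) w
  have h10 := H o (e - 1) p (w - 1)
  clear H
  rcases Nat.even_or_odd' o with ⟨a, rfl | rfl⟩ <;>
  rcases Nat.even_or_odd' e with ⟨b, rfl | rfl⟩ <;>
  rcases Nat.even_or_odd' p with ⟨c, rfl | rfl⟩ <;>
  rcases Nat.even_or_odd' w with ⟨d, rfl | rfl⟩ <;> grind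

/-- A subset with prescribed numbers of elements satisfying and not satisfying a predicate. -/
theorem exists_subset_card_filter {α : Type*} [DecidableEq α] (S : Finset α) (f : α → Prop)
    [DecidablePred f] {p w : ℕ} (hp : p ≤ (S.filter f).card)
    (hw : w ≤ (S.filter fun a ↦ ¬ f a).card) :
    ∃ S' ⊆ S, (S'.filter f).card = p ∧ (S'.filter fun a ↦ ¬ f a).card = w := by
  obtain ⟨P, hP, hPc⟩ := Finset.exists_subset_card_eq hp
  obtain ⟨W, hW, hWc⟩ := Finset.exists_subset_card_eq hw
  have hP' : ∀ a ∈ P, a ∈ S ∧ f a := fun a ha ↦ Finset.mem_filter.1 (hP ha)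
  have hW' : ∀ a ∈ W, a ∈ S ∧ ¬ f a := fun a ha ↦ Finset.mem_filter.1 (hW ha)
  refine ⟨P ∪ W, Finset.union_subset (fun a ha ↦ (hP' a ha).1) (fun a ha ↦ (hW' a ha).1), ?_, ?_⟩
  · rw [← hPc]
    congr 1
    ext a
    simp only [Finset.mem_filter, Finset.mem_union]
    grind
  · rw [← hWc]
    congr 1
    ext a
    simp only [Finset.mem_filter, Finset.mem_union]
    grind

theorem forcesOneProduct_add_two {n : ℕ} [NeZero n] (hn : 3 ≤ n) (heven : Even n) :
    ForcesOneProduct (DihedralGroup n) (n + 2) := by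
  intro A hA
  obtain ⟨N, hN⟩ := even_iff_exists_two_mul.1 heven
  obtain ⟨R, S, rfl⟩ := exists_eq_rotRefl A
  rw [card_rotRefl] at hA
  let f : ZMod n → Prop := fun a ↦ Odd a.val
  have hodd (F : Finset (ZMod n)) : (F.filter f).card ≤ N := by
    have := card_filter_val_mod_le ⟨N, hN⟩ 1 (F.filter f)
      fun a ha ↦ Nat.odd_iff.1 (Finset.mem_filter.1 ha).2
    omega
  have hev (F : Finset (ZMod n)) : (F.filter fun a ↦ ¬ f a).card ≤ N := by
    have := card_filter_val_mod_le ⟨N, hN⟩ 0 (F.filter fun a ↦ ¬ f a)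
      fun a ha ↦ Nat.even_iff.1 (Nat.not_odd_iff_even.1 (Finset.mem_filter.1 ha).2)
    omega
  have hsplit (F : Finset (ZMod n)) := Finset.card_filter_add_card_filter_not (s := F) f
  obtain ⟨o, e, p, w, ho, he, hp, hw, hsum, hpw, hpw2, hop, hmix⟩ :=
    class_count_selection (by omega) (hodd R) (hev R) (hodd S) (hev S)
      (by rw [hsplit, hsplit]; omega)
  obtain ⟨R', hR', rfl, rfl⟩ := exists_subset_card_filter R f ho he
  obtain ⟨S', hS', rfl, rfl⟩ := exists_subset_card_filter S f hp hw
  rw [hsplit, hsplit] at hsum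
  rw [hsplit] at hpw hpw2
  refine ⟨rotRefl R' S', rotRefl_subset hR' hS', ?_, ?_⟩
  · rw [card_rotRefl, DihedralGroup.exponent, hsum, ← hN]
    exact ((Nat.lcm_eq_left (even_iff_two_dvd.1 heven)).symm)
  · refine isOneProduct_rotRefl hN (by omega) R' S' hsum hpw hpw2 ?_ ?_
    · have h₁ := Finset.odd_sum_iff_odd_card_odd (s := R') ZMod.val
      have h₂ := Finset.odd_sum_iff_odd_card_odd (s := S') ZMod.val
      rw [← Nat.not_odd_iff_even, Nat.odd_add, ← Nat.not_odd_iff_even, h₁, h₂,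
        Nat.not_odd_iff_even, ← Nat.odd_add, Nat.not_odd_iff_even]
      exact hop
    · have hf (a : ZMod n) : f a ↔ ¬ (2 : ℤ) ∣ (a.val : ℤ) := by
        simp only [f, Nat.odd_iff]
        omega
      rcases hmix with h | ⟨h₁, h₂⟩
      · obtain ⟨a, ha⟩ := Finset.card_pos.1 h
        rw [Finset.mem_filter, hf] at ha
        exact Or.inl ⟨a, ha⟩
      · obtain ⟨x, hx⟩ := Finset.card_pos.1 h₁
        obtain ⟨y, hy⟩ := Finset.card_pos.1 h₂
        rw [Finset.mem_filter, hf] at hx hy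
        refine Or.inr ⟨x, hx.1, y, hy.1, ?_⟩
        have := hx.2
        have := not_not.1 hy.2
        simp only [valDiff]
        omega

/-! ### Lower bounds -/

/-- A one-product set has an even number of reflections. -/
theorem even_card_refl_of_isOneProduct {n : ℕ} {R S : Finset (ZMod n)}
    (h : IsOneProduct (rotRefl R S)) : Even S.card := by
  have key (l : List (DihedralGroup n)) : ∀ P Q : Multiset (ZMod n),
      (l : Multiset (DihedralGroup n)) = P.map DihedralGroup.r + Q.map DihedralGroup.sr →
      ∃ c, l.prod = if Even (Multiset.card Q) then DihedralGroup.r c else DihedralGroup.sr c := by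
    induction l with
    | nil =>
      intro P Q hPQ
      have h0 : Multiset.card Q = 0 := by
        have := congrArg Multiset.card hPQ
        simp only [Multiset.coe_nil, Multiset.card_zero, Multiset.card_add,
          Multiset.card_map] at this
        omega
      exact ⟨0, by simp [h0]⟩
    | cons g l ih =>
      intro P Q hPQ
      have hg : g ∈ P.map DihedralGroup.r + Q.map DihedralGroup.sr := by
        rw [← hPQ]
        simp
      rcases Multiset.mem_add.1 hg with hg | hg
      · obtain ⟨a, ha, rfl⟩ := Multiset.mem_map.1 hg
        obtain ⟨P, rfl⟩ := Multiset.exists_cons_of_mem ha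
        rw [← Multiset.cons_coe, Multiset.map_cons, Multiset.cons_add,
          Multiset.cons_inj_right] at hPQ
        obtain ⟨c, hc⟩ := ih P Q hPQ
        rw [List.prod_cons, hc]
        split_ifs
        · exact ⟨_, DihedralGroup.r_mul_r _ _⟩
        · exact ⟨_, DihedralGroup.r_mul_sr _ _⟩
      · obtain ⟨a, ha, rfl⟩ := Multiset.mem_map.1 hg
        obtain ⟨Q, rfl⟩ := Multiset.exists_cons_of_mem ha
        rw [← Multiset.cons_coe, Multiset.map_cons, Multiset.add_cons,
          Multiset.cons_inj_right] at hPQ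
        obtain ⟨c, hc⟩ := ih P Q hPQ
        by_cases hQ : Even (Multiset.card Q)
        · have hQ' : ¬ Even (Multiset.card (a ::ₘ Q)) := by
            simpa [Nat.even_add_one] using hQ
          rw [List.prod_cons, hc, if_pos hQ]
          exact ⟨_, (DihedralGroup.sr_mul_r _ _).trans (if_neg hQ').symm⟩
        · have hQ' : Even (Multiset.card (a ::ₘ Q)) := by
            simpa [Nat.even_add_one] using hQ
          rw [List.prod_cons, hc, if_neg hQ]
          exact ⟨_, (DihedralGroup.sr_mul_sr _ _).trans (if_pos hQ').symm⟩
  obtain ⟨l, hl, hprod⟩ := h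
  obtain ⟨c, hc⟩ := key l R.val S.val hl
  by_contra hS
  rw [Finset.card_def] at hS
  rw [if_neg hS, hprod, DihedralGroup.one_def] at hc
  exact DihedralGroup.noConfusion rfl (heq_of_eq hc)

theorem sum_univ_zmod_ne_zero {n : ℕ} [NeZero n] (heven : Even n) :
    ∑ a : ZMod n, a ≠ 0 := by
  obtain ⟨N, hN⟩ := even_iff_exists_two_mul.1 heven
  have hpos := NeZero.pos n
  have h : ∑ a : ZMod n, a = ((∑ i ∈ Finset.range n, i : ℕ) : ZMod n) := by
    push_cast
    refine Finset.sum_bij (fun a _ ↦ a.val) (fun a _ ↦ Finset.mem_range.2 (ZMod.val_lt a))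
      (fun a _ b _ hab ↦ ZMod.val_injective n hab)
      (fun i hi ↦ ⟨(i : ZMod n), Finset.mem_univ _,
        ZMod.val_cast_of_lt (Finset.mem_range.1 hi)⟩) (fun a _ ↦ by simp)
  rw [h, Ne, ZMod.natCast_eq_zero_iff]
  rintro ⟨k, hk⟩
  have h2 := Finset.sum_range_id_mul_two n
  rw [hk] at h2
  -- If n divided n(n - 1)/2, then n - 1 would be even.
  have h3 : k * 2 = n - 1 := by
    refine Nat.eq_of_mul_eq_mul_left hpos ?_
    linarith
  omega

theorem not_isOneProduct_univ_rot {n : ℕ} [NeZero n] (heven : Even n) :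
    ¬ IsOneProduct (rotRefl (Finset.univ : Finset (ZMod n)) ∅) := by
  rintro ⟨l, hl, hprod⟩
  have hperm : l.Perm ((Finset.univ : Finset (ZMod n)).toList.map DihedralGroup.r) := by
    rw [← Multiset.coe_eq_coe, hl, ← Multiset.map_coe, Finset.coe_toList]
    simp [rotRefl]
    rfl
  obtain ⟨L, rfl, hL⟩ : ∃ L : List (ZMod n), L.map DihedralGroup.r = l ∧
      L.Perm (Finset.univ : Finset (ZMod n)).toList := by
    have hl' : l ∈ Set.range (List.map (rotEmbedding n)) := by
      rw [Set.range_list_map]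
      intro x hx
      obtain ⟨a, -, ha⟩ := List.mem_map.1 (hperm.mem_iff.1 hx)
      exact ⟨a, ha⟩
    obtain ⟨L, rfl⟩ := hl'
    exact ⟨L, rfl, (List.map_perm_map_iff (rotEmbedding n).injective).1 hperm⟩
  rw [prod_map_r, DihedralGroup.one_def] at hprod
  have := DihedralGroup.r.inj hprod
  rw [hL.sum_eq, Finset.sum_toList] at this
  exact sum_univ_zmod_ne_zero heven this

theorem not_forcesOneProduct_of_le {n k : ℕ} [NeZero n] (heven : Even n) (hk : k ≤ n + 1) :
    ¬ ForcesOneProduct (DihedralGroup n) k := by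
  intro h
  -- All rotations and one reflection: this set of size n + 1 contains a counterexample of every
  -- smaller size.
  obtain ⟨A, hA, hAk⟩ := Finset.exists_subset_card_eq
    (s := rotRefl (Finset.univ : Finset (ZMod n)) {0}) (n := k) (by simpa [card_rotRefl] using hk)
  obtain ⟨B, hBA, hB, hone⟩ := h A hAk
  have hexp : Monoid.exponent (DihedralGroup n) = n := by
    rw [DihedralGroup.exponent]
    exact Nat.lcm_eq_left (even_iff_two_dvd.1 heven)
  obtain ⟨R, S, rfl⟩ := exists_eq_rotRefl B
  have hS : S ⊆ {0} := fun a ha ↦ sr_mem_rotRefl.1 (hA (hBA (sr_mem_rotRefl.2 ha)))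
  have hS0 : S = ∅ := by
    rcases Finset.subset_singleton_iff.1 hS with h | h
    · exact h
    · have := even_card_refl_of_isOneProduct hone
      simp [h] at this
  subst hS0
  rw [card_rotRefl, hexp, Finset.card_empty, add_zero] at hB
  have hR : R = Finset.univ := by
    rw [← Finset.card_eq_iff_eq_univ, ZMod.card, hB]
  exact not_isOneProduct_univ_rot heven (hR ▸ hone)

theorem not_forcesOneProduct_of_odd {n k : ℕ} [NeZero n] (hodd : Odd n) (hk : k ≤ 2 * n) :
    ¬ ForcesOneProduct (DihedralGroup n) k := by
  intro h
  obtain ⟨A, hA, hAk⟩ := Finset.exists_subset_card_eq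
    (s := rotRefl (Finset.univ : Finset (ZMod n)) Finset.univ) (n := k)
    (by rw [card_rotRefl, Finset.card_univ, ZMod.card]; omega)
  obtain ⟨B, hBA, hB, hone⟩ := h A hAk
  obtain ⟨R, S, rfl⟩ := exists_eq_rotRefl B
  have hexp : Monoid.exponent (DihedralGroup n) = 2 * n := by
    rw [DihedralGroup.exponent]
    exact (Nat.Coprime.lcm_eq_mul (Nat.coprime_two_right.2 hodd)).trans (Nat.mul_comm _ _)
  rw [card_rotRefl, hexp] at hB
  have hR : R.card ≤ n := by simpa using Finset.card_le_univ R
  have hS : S.card ≤ n := by simpa using Finset.card_le_univ S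
  -- The exponent is the group order, so every reflection must be used.
  have hSn : S.card = n := by omega
  exact Nat.not_even_iff_odd.2 hodd (hSn ▸ even_card_refl_of_isOneProduct hone)

theorem theorem1 (n : ℕ) [NeZero n] (hn : 3 ≤ n) :
    harborthConstant (DihedralGroup n) = if Even n then n + 2 else 2 * n + 1 := by
  classical
  rw [harborthConstant]
  split_ifs with hex heven heven
  · rw [Nat.find_eq_iff]
    refine ⟨⟨?_, forcesOneProduct_add_two hn heven⟩, fun k hk h ↦
      not_forcesOneProduct_of_le heven (by omega) h.2⟩
    rw [DihedralGroup.nat_card]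
    omega
  · obtain ⟨k, hk, h⟩ := hex
    rw [DihedralGroup.nat_card] at hk
    exact absurd h (not_forcesOneProduct_of_odd (Nat.not_even_iff_odd.1 heven) hk)
  · refine absurd ⟨n + 2, ?_, forcesOneProduct_add_two hn heven⟩ hex
    rw [DihedralGroup.nat_card]
    omega
  · rw [DihedralGroup.nat_card]
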